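/- **Theorem.** Let $K$ be a knot in the 3-sphere, that is, a class of oriented knot diagrams on the 2-sphere up to Reidemeister moves. For a diagram $D$ of $K$ let $\pi(K)=\langle X\mid R\rangle$ be the Wirtinger presentation of the knot group read off from $D$: $X$ has one generator for each unbroken strand of $D$ and $R$ has one relator for each crossing, saying that the generators of the two under-strands are conjugate by the generator of the over-strand, in the direction given by the sign of the crossing. A *meridian* is an element of $\pi(K)$ that is conjugate to $x$ or $x^{-1}$ for some $x\in X$. Let $$\mathcal R_4(K)=\big\langle X \;\big|\; R\cup\{(cd)^2(dc)^{-2} : c,d\in\mathcal C\}\big\rangle,\qquad \mathcal C=\{g x^{\pm1} g^{-1} : g \text{ a word in } X\cup X^{-1},\ x\in X\},$$ and let $\mathcal S_4(K)=\mathcal R_4(K)/H$, where $H$ is the normal subgroup of $\mathcal R_4(K)$ generated by $\{x^2 : x\in X\}$. 1. If $K$ has bridge number $3$ (the least number of overbridges, i.e. of maximal strands passing over at least one crossing and under none, in a diagram of $K$, is $3$), then $\mathcal S_4(K)\cong\mathbb Z_2$ and $\mathcal R_4(K)\cong\mathbb Z$. 2. More generally, if $\pi(K)$ is generated by $3$ (not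 necessarily distinct) meridians, then $\mathcal S_4(K)\cong\mathbb Z_2$ and $\mathcal R_4(K)\cong\mathbb Z$. Both conclusions hold whichever diagram of $K$ is used to define $\mathcal R_4(K)$ and $\mathcal S_4(K)$. -/

import Mathlib

namespace FourMove

/-! ### Oriented knot diagrams as signed Gauss codes -/

/-- One passage of an oriented knot through a crossing of its diagram: the name of the crossing,
whether the knot passes along the over-strand, and whether the crossing is positive,
i.e. whether the directions of the over-strand and the under-strand, in this order, form a
positive basis of the plane. -/
structure Passage where
  label : ℕ
  isOver : Bool
  isPos : Bool
  deriving DecidableEq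

/-- The other passage through the same crossing. -/
def Passage.partner (p : Passage) : Passage := ⟨p.label, !p.isOver, p.isPos⟩

/-- The cyclic word of passages met when the knot is traversed once from a base point. -/
abbrev GaussWord := List Passage

namespace GaussWord

/-- Every crossing that occurs is passed exactly twice, once over and once under,
with one and the same sign. -/
def IsCode (w : GaussWord) : Prop :=
  w.Nodup ∧ (∀ p ∈ w, p.partner ∈ w) ∧ ∀ p ∈ w, ∀ q ∈ w, p.label = q.label → p.isPos = q.isPos

/-- The cyclically next position. -/
def next (w : GaussWord) (i : Fin w.length) : Fin w.length := finRotate w.length i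

/-- The cyclically previous position. -/
def prev (w : GaussWord) (i : Fin w.length) : Fin w.length := (finRotate w.length).symm i

/-- The position of the other passage through the crossing at position `i`. -/
def mate (w : GaussWord) (i : Fin w.length) : Fin w.length :=
  ((List.finRange w.length).find? fun j => decide (w.get j = (w.get i).partner)).getD i

/-- A directed edge of the underlying 4-valent graph of a (nonempty) code: `(i, true)` is the edge
from passage `i` to the next passage, traversed forwards; `(i, false)` is the same edge traversed
backwards. -/
abbrev Dart (w : GaussWord) := Fin w.length × Bool

/-- Walk along a directed edge to the crossing at its end and turn left there. Seen from the
strand passing at position `p`, the other strand of the crossing runs from right to left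
iff (`p` passes over and the sign is positive) or (`p` passes under and the sign is negative). -/
def turnLeft (w : GaussWord) (d : Dart w) : Dart w :=
  let p := if d.2 then w.next d.1 else d.1
  let crossesToLeft : Bool := (w.get p).isOver == (w.get p).isPos
  if crossesToLeft = d.2 then (w.mate p, true) else (w.prev (w.mate p), false)

/-- The faces of the cellular surface of the code: the orbits of `turnLeft`. -/
def faces (w : GaussWord) : Finset (Finset (Dart w)) :=
  Finset.univ.image fun d =>
    (Finset.range (2 * w.length)).image fun k => (turnLeft w)^[k] d

/-- The code is that of a diagram on the 2-sphere. A code with `n ≥ 1` crossings has length `2n`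
and `n` vertices, `2n` edges, so Euler's formula says that there are `n + 2` faces.
The empty code is the crossingless circle. -/
def IsPlanar (w : GaussWord) : Prop := w = [] ∨ 2 * w.faces.card = w.length + 4

end GaussWord

/-- An oriented knot diagram on the 2-sphere. -/
structure KnotDiagram where
  word : GaussWord
  isCode : word.IsCode
  isPlanar : word.IsPlanar

/-! ### Reidemeister moves -/

/-- The two-letter word `x y`, or `y x`, according to the direction of travel. -/
def strand (d : Bool) (x y : Passage) : GaussWord := if d then [x, y] else [y, x]

/-- Elementary changes of Gauss codes: change of base point, renaming of crossings, and the
Reidemeister moves for all orientations. In the third move the top strand crosses the other two at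
`a`, `b`, and the middle strand crosses the bottom strand at `c`; `dt`, `dm`, `db` are the
directions of the three strands along the sides of the triangle. The two conditions on the signs
hold precisely if these three sides bound a triangle. -/
inductive Move : GaussWord → GaussWord → Prop
  | rotate (A B : GaussWord) : Move (A ++ B) (B ++ A)
  | relabel (σ : Equiv.Perm ℕ) (A : GaussWord) :
      Move A (A.map fun p => ⟨σ p.label, p.isOver, p.isPos⟩)
  | first (k : ℕ) (o s : Bool) (A : GaussWord) :
      Move A ([⟨k, o, s⟩, ⟨k, !o, s⟩] ++ A)
  | second (k l : ℕ) (o s d : Bool) (A B : GaussWord) :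
      Move (A ++ B)
        ([⟨k, o, s⟩, ⟨l, o, !s⟩] ++ A ++ strand d ⟨k, !o, s⟩ ⟨l, !o, !s⟩ ++ B)
  | third (a b c : ℕ) (sa sb sc dt dm db : Bool) (A B C : GaussWord)
      (hab : (sa ^^ sb) = (dm ^^ db)) (hac : (sa ^^ sc) = (dt ^^ db)) :
      Move
        (strand dt ⟨a, true, sa⟩ ⟨b, true, sb⟩ ++ A ++
          strand dm ⟨a, false, sa⟩ ⟨c, true, sc⟩ ++ B ++
          strand db ⟨b, false, sb⟩ ⟨c, false, sc⟩ ++ C)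
        (strand (!dt) ⟨a, true, sa⟩ ⟨b, true, sb⟩ ++ A ++
          strand (!dm) ⟨a, false, sa⟩ ⟨c, true, sc⟩ ++ B ++
          strand (!db) ⟨b, false, sb⟩ ⟨c, false, sc⟩ ++ C)
  | third' (a b c : ℕ) (sa sb sc dt dm db : Bool) (A B C : GaussWord)
      (hab : (sa ^^ sb) = (dm ^^ db)) (hac : (sa ^^ sc) = (dt ^^ db)) :
      Move
        (strand dt ⟨a, true, sa⟩ ⟨b, true, sb⟩ ++ A ++
          strand db ⟨b, false, sb⟩ ⟨c, false, sc⟩ ++ B ++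
          strand dm ⟨a, false, sa⟩ ⟨c, true, sc⟩ ++ C)
        (strand (!dt) ⟨a, true, sa⟩ ⟨b, true, sb⟩ ++ A ++
          strand (!db) ⟨b, false, sb⟩ ⟨c, false, sc⟩ ++ B ++
          strand (!dm) ⟨a, false, sa⟩ ⟨c, true, sc⟩ ++ C)

/-- Knot diagrams up to Reidemeister moves, all intermediate diagrams lying on the sphere. -/
def KnotDiagram.setoid : Setoid KnotDiagram :=
  Relation.EqvGen.setoid fun D E => Move D.word E.word

/-- An (oriented) classical knot: a Reidemeister equivalence class of diagrams. -/
def Knot := Quotient KnotDiagram.setoid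

/-- `D` is a diagram of the knot `K`. -/
def KnotDiagram.Represents (D : KnotDiagram) (K : Knot) : Prop :=
  Quotient.mk KnotDiagram.setoid D = K

/-! ### Bridge number -/

/-- The number of overbridges of a diagram, i.e. of maximal strands that pass over at least one
crossing and under none (counted at their starting points); the crossingless circle counts as
one bridge. -/
def KnotDiagram.bridgeCount (D : KnotDiagram) : ℕ :=
  if D.word = [] then 1 else
    (Finset.univ.filter fun i : Fin D.word.length =>
      (D.word.get i).isOver = false ∧ (D.word.get (D.word.next i)).isOver = true).card

/-- The bridge number of a knot: the least number of overbridges in a diagram of it. -/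
noncomputable def Knot.bridgeNumber (K : Knot) : ℕ :=
  sInf {n | ∃ D : KnotDiagram, D.Represents K ∧ D.bridgeCount = n}

/-! ### The Wirtinger presentation -/

/-- The base point cuts the knot into edges `0, …, length`, where passage `i` leads from edge `i`
to edge `i + 1`. The last edge continues the edge `0` through the base point, and an over-passage
does not interrupt the strand. -/
inductive KnotDiagram.Joined (D : KnotDiagram) :
    Fin (D.word.length + 1) → Fin (D.word.length + 1) → Prop
  | basePoint : Joined D (Fin.last _) 0
  | overpass (i : Fin D.word.length) (h : (D.word.get i).isOver = true) :
      Joined D i.castSucc i.succ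

/-- The unbroken strands of the diagram. -/
def KnotDiagram.Arc (D : KnotDiagram) := Quot D.Joined

/-- The Wirtinger generator of the strand that contains a given edge. -/
def KnotDiagram.gen (D : KnotDiagram) (e : Fin (D.word.length + 1)) : FreeGroup D.Arc :=
  FreeGroup.of (Quot.mk D.Joined e)

/-- The Wirtinger relators: if passage `i` goes under the crossing whose over-passage is `j`, then
the generator behind the crossing is the conjugate of the generator in front of it by the
generator of the over-strand, or by its inverse, according to the sign. -/
def KnotDiagram.wirtingerRels (D : KnotDiagram) : Set (FreeGroup D.Arc) :=
  {r | ∃ i j : Fin D.word.length,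
    (D.word.get i).isOver = false ∧ D.word.get j = (D.word.get i).partner ∧
      r = if (D.word.get i).isPos
        then D.gen j.castSucc * D.gen i.succ * (D.gen i.castSucc * D.gen j.castSucc)⁻¹
        else D.gen i.succ * D.gen j.castSucc * (D.gen j.castSucc * D.gen i.castSucc)⁻¹}

/-- The knot group `π(K)`, by its Wirtinger presentation. -/
abbrev KnotDiagram.WirtingerGroup (D : KnotDiagram) := PresentedGroup D.wirtingerRels

/-- Meridians: the conjugates of the Wirtinger generators and of their inverses. -/
def KnotDiagram.IsMeridian (D : KnotDiagram) (g : D.WirtingerGroup) : Prop :=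
  ∃ x : D.Arc, IsConj (PresentedGroup.of x) g ∨ IsConj (PresentedGroup.of x)⁻¹ g

/-- The group of `K` is generated by `n` (not necessarily distinct) meridians. -/
def Knot.GroupGeneratedByMeridians (K : Knot) (n : ℕ) : Prop :=
  ∃ D : KnotDiagram, D.Represents K ∧ ∃ m : Fin n → D.WirtingerGroup,
    (∀ i, D.IsMeridian (m i)) ∧ Subgroup.closure (Set.range m) = ⊤

/-! ### The groups `R₄` and `S₄` -/

/-- The words `g x^{±1} g⁻¹` with `x` a Wirtinger generator. -/
def KnotDiagram.conjugates (D : KnotDiagram) : Set (FreeGroup D.Arc) :=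
  {c | ∃ (g : FreeGroup D.Arc) (x : D.Arc),
    c = g * FreeGroup.of x * g⁻¹ ∨ c = g * (FreeGroup.of x)⁻¹ * g⁻¹}

/-- The relators `(c d)² (d c)⁻²`, with `c` and `d` conjugates of generators or their inverses. -/
def KnotDiagram.fourMoveRels (D : KnotDiagram) : Set (FreeGroup D.Arc) :=
  {r | ∃ c ∈ D.conjugates, ∃ d ∈ D.conjugates, r = (c * d) ^ 2 * ((d * c) ^ 2)⁻¹}

/-- The Dabkowski–Sahi group of the diagram. -/
abbrev KnotDiagram.R₄ (D : KnotDiagram) := PresentedGroup (D.wirtingerRels ∪ D.fourMoveRels)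

/-- The normal subgroup of `R₄` generated by the squares of the Wirtinger generators. -/
def KnotDiagram.squares (D : KnotDiagram) : Subgroup D.R₄ :=
  Subgroup.normalClosure (Set.range fun x : D.Arc => (PresentedGroup.of x : D.R₄) ^ 2)

instance (D : KnotDiagram) : D.squares.Normal := Subgroup.normalClosure_normal

/-- The quotient of `R₄` by the squares of the Wirtinger generators. -/
abbrev KnotDiagram.S₄ (D : KnotDiagram) := D.R₄ ⧸ D.squares

end FourMove

namespace FourMove

/-! ### Groups generated by three conjugate elements -/

section GroupTheory

variable {G : Type*} [Group G]

/-! The heart is a fact about groups: if three conjugate elements `a`, `b`, `c` generate `G`, and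
`(xy)² = (yx)²` for all conjugates `x`, `y` of `a` or `a⁻¹`, then `G` is generated by `a` alone
(`mem_zpowers_of_fourMove`). For involutions, the conjugates of `a` by rotations and those by
reflections of the dihedral group `⟨b, c⟩` generate two commuting subgroups. Their join is normal
and hence everything; this makes the first one everything, the second one central, and `a` central.
In general, divide by the normal closure of `a²`. Squares of conjugates of `a` commute
(`commute_sq_of_fourMove`), so `a²` turns out to be central and the kernel is just `⟨a²⟩`.

Hence if the generators of `R₄` form a coloring whose group is generated by three conjugates of the
base color, then `R₄` is cyclic on a conjugate of a Wirtinger generator. Sending every generator to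
`1` maps it onto `ℤ`, or onto `ℤ/2` after killing squares, and these maps are isomorphisms
(`nonempty_mulEquiv`).

Independence of the diagram needs no isomorphism of knot groups. The property
`GeneratedByConjugates` speaks of all Wirtinger colorings in all groups, and colorings are carried
across each Reidemeister move (`Transfers.of_move`). It holds for a diagram with three overbridges
because their colors generate (`generatedByConjugates_bridgeCount`), and for one with three
generating meridians because a generating coloring is a surjection from the knot group
(`generatedByConjugates_of_isMeridian`). -/

theorem commute_conj_sq {c d : G} (h₁ : (c * d) ^ 2 = (d * c) ^ 2)
    (h₂ : (c * d⁻¹) ^ 2 = (d⁻¹ * c) ^ 2) : Commute (c * d ^ 2 * c⁻¹) d := by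
  have e₁ : Commute (c * d * c) d := by
    have : c * d * c * d = d * (c * d * c) := by simpa [pow_two, mul_assoc] using h₁
    exact this
  have e₂ : Commute (c * d⁻¹ * c) d := by
    have : c * d⁻¹ * c * d⁻¹ = d⁻¹ * (c * d⁻¹ * c) := by simpa [pow_two, mul_assoc] using h₂
    exact Commute.inv_right_iff.1 this
  -- Each hypothesis says that one of these two factors commutes with `d`.
  have e₃ : c * d ^ 2 * c⁻¹ = c * d * c * (c * d⁻¹ * c)⁻¹ := by simp [pow_two, mul_assoc]
  rw [e₃]
  exact e₁.mul_left e₂.inv_left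

/-- Squares of elements of a set closed under inversion commute if any two elements `c`, `d` of
the set satisfy `(c d)² = (d c)²`. -/
theorem commute_sq_of_fourMove {C : Set G} (hinv : ∀ x ∈ C, x⁻¹ ∈ C)
    (h : ∀ x ∈ C, ∀ y ∈ C, (x * y) ^ 2 = (y * x) ^ 2) {x y : G} (hx : x ∈ C) (hy : y ∈ C) :
    Commute (x ^ 2) (y ^ 2) := by
  have h₁ := commute_conj_sq (h _ (hinv y hy) x hx) (h _ (hinv y hy) _ (hinv x hx))
  have h₂ : Commute (x ^ 2) (y * x * y⁻¹) := by
    have := (Commute.conj_iff y).2 h₁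
    have e : y * (y⁻¹ * x ^ 2 * y⁻¹⁻¹) * y⁻¹ = x ^ 2 := by simp [mul_assoc]
    rwa [e] at this
  have h₃ := h x hx y hy
  have e : x * y * x * y = y * x * y * x := by simpa [pow_two, mul_assoc] using h₃
  -- On `x`, conjugation by `y²` agrees with conjugation by the inverse of `w = y x y⁻¹`, and by
  -- `h₂` this `w` commutes with `x²`.
  have h₄ : y ^ 2 * x * (y ^ 2)⁻¹ = (y * x * y⁻¹)⁻¹ * x * (y * x * y⁻¹) := by
    calc y ^ 2 * x * (y ^ 2)⁻¹ = y * x⁻¹ * y⁻¹ * (y * x * y * x) * y⁻¹ * y⁻¹ := by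
          simp [pow_two, mul_assoc]
      _ = y * x⁻¹ * y⁻¹ * (x * y * x * y) * y⁻¹ * y⁻¹ := by rw [e]
      _ = _ := by simp [mul_assoc]
  have h₅ : y ^ 2 * x ^ 2 * (y ^ 2)⁻¹ = x ^ 2 := by
    calc y ^ 2 * x ^ 2 * (y ^ 2)⁻¹ = (y ^ 2 * x * (y ^ 2)⁻¹) ^ 2 := by
          rw [conj_pow]
      _ = ((y * x * y⁻¹)⁻¹ * x * (y * x * y⁻¹)) ^ 2 := by rw [h₄]
      _ = (y * x * y⁻¹)⁻¹ * (x ^ 2 * (y * x * y⁻¹)) := by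
          generalize y * x * y⁻¹ = w
          simp [pow_two, mul_assoc]
      _ = x ^ 2 := by rw [h₂.eq, inv_mul_cancel_left]
  exact (mul_inv_eq_iff_eq_mul.1 h₅).symm

theorem normal_of_closure_eq_top {S : Set G} (hS : Subgroup.closure S = ⊤) {K : Subgroup G}
    (h : ∀ s ∈ S, ∀ k ∈ K, s * k * s⁻¹ ∈ K) (h' : ∀ s ∈ S, ∀ k ∈ K, s⁻¹ * k * s ∈ K) :
    K.Normal := by
  refine ⟨fun k hk g => ?_⟩
  have hg : g ∈ Subgroup.closure S := hS ▸ Subgroup.mem_top g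
  induction hg using Subgroup.closure_induction'' generalizing k with
  | mem x hx => exact h x hx k hk
  | inv_mem x hx => simpa using h' x hx k hk
  | one => simpa using hk
  | mul x y _ _ hx hy => simpa [mul_assoc] using hx _ (hy k hk)

theorem conj_closure_mem {S : Set G} {K : Subgroup G} {b : G}
    (h : ∀ s ∈ S, b * s * b⁻¹ ∈ K) {k : G} (hk : k ∈ Subgroup.closure S) :
    b * k * b⁻¹ ∈ K := by
  have : Subgroup.closure S ≤ K.comap (MulAut.conj b).toMonoidHom :=
    (Subgroup.closure_le _).2 fun s hs => by simpa using h s hs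
  simpa using this hk

theorem eq_top_of_normal_of_mem {a b c : G} (hab : IsConj a b) (hac : IsConj a c)
    (hgen : Subgroup.closure {a, b, c} = ⊤) {K : Subgroup G} (hK : K.Normal) (ha : a ∈ K) :
    K = ⊤ := by
  obtain ⟨u, rfl⟩ := isConj_iff.1 hab
  obtain ⟨v, rfl⟩ := isConj_iff.1 hac
  rw [eq_top_iff, ← hgen, Subgroup.closure_le]
  rintro x (rfl | rfl | rfl)
  exacts [ha, hK.conj_mem _ ha _, hK.conj_mem _ ha _]

/-- A group generated by three conjugate involutions `a`, `b`, `c`, in which any two conjugates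
`x`, `y` of `a` satisfy `(x y)² = (y x)²`, is generated by `a`. -/
theorem mem_zpowers_of_involutions {a b c : G} (hab : IsConj a b) (hac : IsConj a c)
    (hgen : Subgroup.closure {a, b, c} = ⊤) (ha : a * a = 1)
    (h : ∀ x y, IsConj a x → IsConj a y → (x * y) ^ 2 = (y * x) ^ 2) (g : G) :
    g ∈ Subgroup.zpowers a := by
  have inv_of : ∀ {x}, IsConj a x → x * x = 1 := by
    intro x hx
    obtain ⟨u, rfl⟩ := isConj_iff.1 hx
    calc u * a * u⁻¹ * (u * a * u⁻¹) = u * (a * a) * u⁻¹ := by group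
      _ = 1 := by rw [ha]; group
  have hb := inv_of hab
  have hc := inv_of hac
  have ha' : a⁻¹ = a := inv_eq_of_mul_eq_one_left ha
  have hb' : b⁻¹ = b := inv_eq_of_mul_eq_one_left hb
  have hc' : c⁻¹ = c := inv_eq_of_mul_eq_one_left hc
  -- For involutions `(a y)² = (y a)²` says precisely that `a` commutes with `y a y`.
  have hcomm : ∀ y, IsConj a y → Commute a (y * a * y⁻¹) := by
    intro y hy
    have hy' : y⁻¹ = y := inv_eq_of_mul_eq_one_left (inv_of hy)
    have := h a y (IsConj.refl a) hy
    rw [hy']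
    calc a * (y * a * y) = (a * y) ^ 2 := by simp [pow_two, mul_assoc]
      _ = (y * a) ^ 2 := this
      _ = y * a * y * a := by simp [pow_two, mul_assoc]
  -- `r` is the rotation of the dihedral group `⟨b, c⟩`; its reflections are the `r ^ i * b`.
  set r := b * c with hr
  have hrb : ∀ i : ℤ, b * r ^ i = r ^ (-i) * b := by
    intro i
    have : b * r * b⁻¹ = r⁻¹ := by rw [hr, mul_inv_rev, hb', hc', ← mul_assoc, hb, one_mul]
    have h2 : b * r ^ i * b⁻¹ = r ^ (-i) := by
      rw [← conj_zpow, this, inv_zpow']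
    rw [← h2]; group
  have hcb : c = b * r := by rw [hr, ← mul_assoc, hb, one_mul]
  have hrc : ∀ i : ℤ, c * r ^ i = r ^ (-i - 1) * b := by
    intro i
    rw [hcb, mul_assoc, ← zpow_one_add, hrb]
    congr 2; ring
  -- `r ^ (2k) * b` is the conjugate of `b` by `r ^ k`, and `r ^ (2k+1) * b` that of `c` by `r ^
  -- (k+1)`.
  have hrefl : ∀ i : ℤ, IsConj a (r ^ i * b) := by
    intro i
    obtain ⟨k, rfl | rfl⟩ := Int.even_or_odd' i
    · refine hab.trans (isConj_iff.2 ⟨r ^ k, ?_⟩)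
      rw [mul_assoc, ← zpow_neg, hrb, ← mul_assoc, ← zpow_add]
      congr 2; ring
    · refine hac.trans (isConj_iff.2 ⟨r ^ (k + 1), ?_⟩)
      rw [mul_assoc, ← zpow_neg, hrc, ← mul_assoc, ← zpow_add]
      congr 2; ring
  let E := Subgroup.closure (Set.range fun i : ℤ => r ^ i * a * (r ^ i)⁻¹)
  let O := Subgroup.closure (Set.range fun i : ℤ => (r ^ i * b) * a * (r ^ i * b)⁻¹)
  have haE : a ∈ E := Subgroup.subset_closure ⟨0, by simp⟩
  have hEO : ∀ e ∈ E, ∀ o ∈ O, Commute e o := by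
    intro e he o ho
    have hO : O ≤ Subgroup.centralizer (E : Set G) := by
      rw [Subgroup.centralizer_closure, Subgroup.closure_le]
      rintro _ ⟨j, rfl⟩
      rw [SetLike.mem_coe, Subgroup.mem_centralizer_iff]
      rintro _ ⟨i, rfl⟩
      -- A rotation and a reflection differ by a reflection, so after conjugation this is `hcomm`.
      have := (Commute.conj_iff (r ^ i)).2 (hcomm _ (hrefl (j - i)))
      have e : r ^ i * (r ^ (j - i) * b * a * (r ^ (j - i) * b)⁻¹) * (r ^ i)⁻¹
          = (r ^ j * b) * a * (r ^ j * b)⁻¹ := by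
        rw [zpow_sub]; group
      rw [e] at this
      exact this.eq
    exact Subgroup.mem_centralizer_iff.1 (hO ho) e he
  -- `a` lies in `E`, while conjugation by `b` or `c` exchanges the two families of generators.
  have hEOn : (E ⊔ O).Normal := by
    have hE : E ≤ E ⊔ O := le_sup_left
    have hO : O ≤ E ⊔ O := le_sup_right
    have hsup : E ⊔ O = Subgroup.closure ((Set.range fun i : ℤ => r ^ i * a * (r ^ i)⁻¹) ∪
      (Set.range fun i : ℤ => (r ^ i * b) * a * (r ^ i * b)⁻¹)) := (Subgroup.closure_union _ _).symm
    have key : ∀ s ∈ ({a, b, c} : Set G), ∀ k ∈ E ⊔ O, s * k * s⁻¹ ∈ E ⊔ O := by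
      rintro s (rfl | rfl | rfl) k hk
      · exact mul_mem (mul_mem (hE haE) hk) (inv_mem (hE haE))
      · rw [hsup] at hk
        refine conj_closure_mem ?_ hk
        rintro _ (⟨i, rfl⟩ | ⟨i, rfl⟩)
        · refine hO (Subgroup.subset_closure ⟨-i, ?_⟩)
          dsimp only
          rw [← hrb]; group
        · refine hE (Subgroup.subset_closure ⟨-i, ?_⟩)
          have : r ^ (-i) = s * (r ^ i * s) := by rw [← mul_assoc, hrb, mul_assoc, hb, mul_one]
          dsimp only
          rw [this]; group
      · rw [hsup] at hk
        refine conj_closure_mem ?_ hk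
        rintro _ (⟨i, rfl⟩ | ⟨i, rfl⟩)
        · refine hO (Subgroup.subset_closure ⟨-i - 1, ?_⟩)
          dsimp only
          rw [← hrc]; group
        · refine hE (Subgroup.subset_closure ⟨-i - 1, ?_⟩)
          have : r ^ (-i - 1) = s * (r ^ i * b) := by
            rw [← mul_assoc, hrc, mul_assoc, hb, mul_one]
          dsimp only
          rw [this]; group
    refine normal_of_closure_eq_top hgen key fun s hs k hk => ?_
    have hs' : s⁻¹ = s := by
      rcases hs with rfl | rfl | rfl <;> assumption
    have := key s hs k hk
    rwa [hs'] at this ⊢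
  have hEOtop := eq_top_of_normal_of_mem hab hac hgen hEOn (le_sup_left (a := E) haE)
  -- The whole group is `E ⊔ O`; `E` normalizes itself and `O` centralizes it.
  have hEn : E.Normal := by
    have hle : ((E : Set G) ∪ O) ⊆ {g | ∀ k ∈ E, g * k * g⁻¹ ∈ E} := by
      rintro g (hg | hg) k hk
      · exact mul_mem (mul_mem hg hk) (inv_mem hg)
      · rw [← (hEO k hk g hg).eq, mul_inv_cancel_right]; exact hk
    refine normal_of_closure_eq_top (S := (E : Set G) ∪ O)
      (by rw [Subgroup.closure_union, Subgroup.closure_eq, Subgroup.closure_eq, hEOtop])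
      (fun s hs => hle hs) fun s hs k hk => ?_
    have := hle (a := s⁻¹) (by rcases hs with hs | hs; exacts [.inl (inv_mem hs), .inr (inv_mem hs)])
    simpa using this k hk
  have hEtop := eq_top_of_normal_of_mem hab hac hgen hEn haE
  -- Now that `E` is everything, `O` is central, and it contains a conjugate of `a`.
  have hbab : ∀ g, Commute g (b * a * b⁻¹) := fun g =>
    hEO g (hEtop ▸ Subgroup.mem_top g) _ (Subgroup.subset_closure ⟨0, by simp⟩)
  have hcen : ∀ g, Commute g a := fun g => by
    have := (Commute.conj_iff b⁻¹).2 (hbab (b * g * b⁻¹))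
    simpa [mul_assoc] using this
  have hz : (Subgroup.zpowers a).Normal := ⟨fun n hn g => by
    obtain ⟨k, rfl⟩ := Subgroup.mem_zpowers_iff.1 hn
    rw [((hcen g).zpow_right k).eq, mul_inv_cancel_right]; exact hn⟩
  rw [eq_top_of_normal_of_mem hab hac hgen hz (Subgroup.mem_zpowers a)]
  exact Subgroup.mem_top g

/-- A group generated by three conjugate elements `a`, `b`, `c`, in which any two conjugates
`x`, `y` of `a` or `a⁻¹` satisfy `(x y)² = (y x)²`, is generated by `a`. -/
theorem mem_zpowers_of_fourMove {a b c : G} (hab : IsConj a b) (hac : IsConj a c)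
    (hgen : Subgroup.closure {a, b, c} = ⊤)
    (h : ∀ x y, IsConj a x ∨ IsConj a⁻¹ x → IsConj a y ∨ IsConj a⁻¹ y →
      (x * y) ^ 2 = (y * x) ^ 2) (g : G) :
    g ∈ Subgroup.zpowers a := by
  set N := Subgroup.normalClosure {a ^ 2} with hN
  let π := QuotientGroup.mk' N
  have hπ : Function.Surjective π := QuotientGroup.mk'_surjective N
  have hdecomp : ∀ g : G, ∃ k : ℤ, ∃ n ∈ N, g = a ^ k * n := by
    intro g
    have hg : π g ∈ Subgroup.zpowers (π a) := by
      refine mem_zpowers_of_involutions (π.map_isConj hab) (π.map_isConj hac) ?_ ?_ ?_ _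
      · have := congrArg (Subgroup.map π) hgen
        rwa [MonoidHom.map_closure, Subgroup.map_top_of_surjective π hπ, Set.image_insert_eq,
          Set.image_pair] at this
      · rw [← map_mul, ← pow_two]
        exact (QuotientGroup.eq_one_iff _).2 (Subgroup.subset_normalClosure rfl)
      · intro x y hx hy
        obtain ⟨u, rfl⟩ := isConj_iff.1 hx
        obtain ⟨v, rfl⟩ := isConj_iff.1 hy
        obtain ⟨u, rfl⟩ := hπ u
        obtain ⟨v, rfl⟩ := hπ v
        simp only [← map_mul, ← map_inv, ← map_pow]
        rw [h _ _ (.inl (isConj_iff.2 ⟨u, rfl⟩)) (.inl (isConj_iff.2 ⟨v, rfl⟩))]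
    obtain ⟨k, hk⟩ := Subgroup.mem_zpowers_iff.1 hg
    refine ⟨k, (a ^ k)⁻¹ * g, ?_, by simp⟩
    rw [← map_zpow] at hk
    exact QuotientGroup.eq.1 hk
  have hsq : ∀ n ∈ N, Commute n (a ^ 2) := by
    intro n hn
    have hle : N ≤ Subgroup.centralizer {a ^ 2} := by
      rw [hN, Subgroup.normalClosure, Subgroup.closure_le]
      intro z hz
      obtain ⟨y, rfl, hyz⟩ := Group.mem_conjugatesOfSet_iff.1 hz
      obtain ⟨u, rfl⟩ := isConj_iff.1 hyz
      rw [SetLike.mem_coe, Subgroup.mem_centralizer_singleton_iff, ← conj_pow]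
      refine (commute_sq_of_fourMove (C := {x | IsConj a x ∨ IsConj a⁻¹ x}) ?_
        (fun x hx y hy => h x y hx hy) (.inl (isConj_iff.2 ⟨u, rfl⟩)) (.inl (IsConj.refl a))).eq
      rintro x (hx | hx) <;> obtain ⟨v, rfl⟩ := isConj_iff.1 hx
      · exact .inr (isConj_iff.2 ⟨v, by group⟩)
      · exact .inl (isConj_iff.2 ⟨v, by group⟩)
    exact Subgroup.mem_centralizer_singleton_iff.1 (hle hn)
  -- Every element is a power of `a` times an element of `N`, and both commute with `a²`.
  have hcen : ∀ g : G, g * a ^ 2 * g⁻¹ = a ^ 2 := by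
    intro g
    obtain ⟨k, n, hn, rfl⟩ := hdecomp g
    calc a ^ k * n * a ^ 2 * (a ^ k * n)⁻¹ = a ^ k * (n * a ^ 2) * n⁻¹ * (a ^ k)⁻¹ := by group
      _ = a ^ 2 := by rw [(hsq n hn).eq]; group
  have hNz : N ≤ Subgroup.zpowers a := by
    rw [hN, Subgroup.normalClosure, Subgroup.closure_le]
    intro z hz
    obtain ⟨y, rfl, hyz⟩ := Group.mem_conjugatesOfSet_iff.1 hz
    obtain ⟨u, rfl⟩ := isConj_iff.1 hyz
    rw [hcen]
    exact pow_mem (Subgroup.mem_zpowers a) 2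
  obtain ⟨k, n, hn, rfl⟩ := hdecomp g
  exact mul_mem (zpow_mem (Subgroup.mem_zpowers a) k) (hNz hn)

end GroupTheory

end FourMove

namespace FourMove

/-! ### Colorings of Gauss words by group elements -/

section Coloring

variable {G : Type*} [Group G]

/-- The color behind the passage `p` if the color in front of it is `g`, and `h` gives the colors
of the over-strands of the crossings. -/
def step (h : ℕ → G) (p : Passage) (g : G) : G :=
  if p.isOver then g
  else if p.isPos then (h p.label)⁻¹ * g * h p.label
  else h p.label * g * (h p.label)⁻¹

/-- The color at the end of the path `w` that starts with color `g`. -/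
def run (h : ℕ → G) : GaussWord → G → G
  | [], g => g
  | p :: w, g => run h w (step h p g)

/-- Along the path `w` that starts with color `g`, all over-passages have the colors prescribed
by `h`. -/
def Fits (h : ℕ → G) : GaussWord → G → Prop
  | [], _ => True
  | p :: w, g => (p.isOver = true → h p.label = g) ∧ Fits h w (step h p g)

/-- A Wirtinger coloring of a closed Gauss word. -/
def IsColoring (w : GaussWord) (h : ℕ → G) (g : G) : Prop := Fits h w g ∧ run h w g = g

@[simp] theorem run_nil (h : ℕ → G) (g : G) : run h [] g = g := rfl
@[simp] theorem run_cons (h : ℕ → G) (p : Passage) (w : GaussWord) (g : G) :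
    run h (p :: w) g = run h w (step h p g) := rfl
@[simp] theorem fits_nil (h : ℕ → G) (g : G) : Fits h [] g ↔ True := Iff.rfl
@[simp] theorem fits_cons (h : ℕ → G) (p : Passage) (w : GaussWord) (g : G) :
    Fits h (p :: w) g ↔ (p.isOver = true → h p.label = g) ∧ Fits h w (step h p g) := Iff.rfl

@[simp] theorem run_append (h : ℕ → G) (v w : GaussWord) (g : G) :
    run h (v ++ w) g = run h w (run h v g) := by
  induction v generalizing g with
  | nil => rfl
  | cons p v ih => simp [ih]

@[simp] theorem fits_append (h : ℕ → G) (v w : GaussWord) (g : G) :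
    Fits h (v ++ w) g ↔ Fits h v g ∧ Fits h w (run h v g) := by
  induction v generalizing g with
  | nil => simp
  | cons p v ih => simp [ih, and_assoc]

theorem step_congr {h h' : ℕ → G} {p : Passage} (e : h p.label = h' p.label) (g : G) :
    step h p g = step h' p g := by
  simp [step, e]

theorem run_congr {h h' : ℕ → G} {w : GaussWord} (e : ∀ p ∈ w, h p.label = h' p.label) (g : G) :
    run h w g = run h' w g := by
  induction w generalizing g with
  | nil => rfl
  | cons p w ih =>
    rw [run_cons, run_cons, step_congr (e p (by simp)), ih fun q hq => e q (by simp [hq])]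

theorem fits_congr {h h' : ℕ → G} {w : GaussWord} (e : ∀ p ∈ w, h p.label = h' p.label) (g : G) :
    Fits h w g ↔ Fits h' w g := by
  induction w generalizing g with
  | nil => rfl
  | cons p w ih =>
    rw [fits_cons, fits_cons, step_congr (e p (by simp)), ih fun q hq => e q (by simp [hq]),
      e p (by simp)]

theorem isConj_step (h : ℕ → G) (p : Passage) (g : G) : IsConj g (step h p g) := by
  unfold step
  split_ifs
  · exact IsConj.refl g
  · exact isConj_iff.2 ⟨(h p.label)⁻¹, by simp⟩
  · exact isConj_iff.2 ⟨h p.label, rfl⟩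

theorem isConj_run (h : ℕ → G) (w : GaussWord) (g : G) : IsConj g (run h w g) := by
  induction w generalizing g with
  | nil => exact IsConj.refl g
  | cons p w ih => exact (isConj_step h p g).trans (ih _)

theorem step_mem_iff {h : ℕ → G} {H : Subgroup G} {p : Passage} (hp : h p.label ∈ H) {g : G} :
    step h p g ∈ H ↔ g ∈ H := by
  unfold step
  split_ifs
  · rfl
  · rw [H.mul_mem_cancel_right hp, H.mul_mem_cancel_left (inv_mem hp)]
  · rw [H.mul_mem_cancel_right (inv_mem hp), H.mul_mem_cancel_left hp]

/-- Walking along the word conjugates the color by over-colors in `H` or their inverses, so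
membership in `H` may be tested at any edge of the path. -/
theorem run_mem_iff {h : ℕ → G} {H : Subgroup G} {w : GaussWord} (hw : ∀ p ∈ w, h p.label ∈ H)
    {g : G} : run h w g ∈ H ↔ g ∈ H := by
  induction w generalizing g with
  | nil => rfl
  | cons p w ih =>
    rw [run_cons, ih fun q hq => hw q (by simp [hq]), step_mem_iff (hw p (by simp))]

/-- Every coloring of `w` gives rise to a coloring of `w'` whose colors generate at least the same
subgroup, and whose base color is conjugate to that of the given one. -/
def Transfers (w w' : GaussWord) : Prop :=
  ∀ (G : Type) [Group G] (h : ℕ → G) (g : G), IsColoring w h g →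
    ∃ (h' : ℕ → G) (g' : G), IsColoring w' h' g' ∧ IsConj g g' ∧
      ∀ H : Subgroup G, g' ∈ H → (∀ p ∈ w', h' p.label ∈ H) → g ∈ H ∧ ∀ p ∈ w, h p.label ∈ H

/-! ### Transport of colorings along base point changes, relabelings and the first two moves -/

theorem Transfers.rotate (A B : GaussWord) : Transfers (A ++ B) (B ++ A) := by
  rintro G _ h g ⟨hf, hr⟩
  rw [fits_append] at hf
  rw [run_append] at hr
  refine ⟨h, run h A g, ⟨?_, ?_⟩, isConj_run h A g, fun H hg hH => ⟨?_, fun p hp => ?_⟩⟩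
  · rw [fits_append, hr]; exact hf.symm
  · rw [run_append, hr]
  · exact (run_mem_iff fun p hp => hH p (by simp [hp])).1 hg
  · exact hH p (by simpa [or_comm] using hp)

theorem run_map_relabel (h : ℕ → G) (σ : ℕ → ℕ) (w : GaussWord) (g : G) :
    run h (w.map fun p => ⟨σ p.label, p.isOver, p.isPos⟩) g = run (h ∘ σ) w g := by
  induction w generalizing g with
  | nil => rfl
  | cons p w ih => rw [List.map_cons, run_cons, ih]; rfl

theorem fits_map_relabel (h : ℕ → G) (σ : ℕ → ℕ) (w : GaussWord) (g : G) :
    Fits h (w.map fun p => ⟨σ p.label, p.isOver, p.isPos⟩) g ↔ Fits (h ∘ σ) w g := by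
  induction w generalizing g with
  | nil => rfl
  | cons p w ih => rw [List.map_cons, fits_cons, ih]; rfl

theorem Transfers.relabel (σ : Equiv.Perm ℕ) (w : GaussWord) :
    Transfers w (w.map fun p => ⟨σ p.label, p.isOver, p.isPos⟩) := by
  rintro G _ h g ⟨hf, hr⟩
  have e : (h ∘ σ.symm) ∘ σ = h := by ext; simp
  refine ⟨h ∘ σ.symm, g, ⟨?_, ?_⟩, IsConj.refl g, fun H hg hH => ⟨hg, fun p hp => ?_⟩⟩
  · rwa [fits_map_relabel, e]
  · rwa [run_map_relabel, e]
  · simpa using hH _ (List.mem_map_of_mem hp)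

theorem Transfers.relabel_symm (σ : Equiv.Perm ℕ) (w : GaussWord) :
    Transfers (w.map fun p => ⟨σ p.label, p.isOver, p.isPos⟩) w := by
  rintro G _ h g ⟨hf, hr⟩
  rw [fits_map_relabel] at hf
  rw [run_map_relabel] at hr
  refine ⟨h ∘ σ, g, ⟨hf, hr⟩, IsConj.refl g, fun H hg hH => ⟨hg, fun p hp => ?_⟩⟩
  obtain ⟨q, hq, rfl⟩ := List.mem_map.1 hp
  exact hH q hq

theorem GaussWord.IsCode.eq_or_eq {w : GaussWord} (hw : w.IsCode) {p q : Passage} (hp : p ∈ w)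
    (hq : q ∈ w) (h : q.label = p.label) : q = p ∨ q = p.partner := by
  have hs := hw.2.2 q hq p hp h
  obtain ⟨l, o, s⟩ := p
  obtain ⟨l', o', s'⟩ := q
  simp only at h hs
  subst h hs
  cases o <;> cases o' <;> simp [Passage.partner]

/-- A crossing both passages of which lie in one part of a code does not occur in the rest. -/
theorem GaussWord.IsCode.label_ne {U V : GaussWord} {p : Passage}
    (hw : GaussWord.IsCode (U ++ V)) (hp : p ∈ U) (hp' : p.partner ∈ U) :
    ∀ q ∈ V, q.label ≠ p.label := by
  intro q hq e
  have hd := List.disjoint_of_nodup_append hw.1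
  rcases hw.eq_or_eq (List.mem_append_left _ hp) (List.mem_append_right _ hq) e with rfl | rfl
  exacts [hd hp hq, hd hp' hq]

theorem GaussWord.IsCode.perm {v w : GaussWord} (hv : v.IsCode) (h : v.Perm w) : w.IsCode :=
  ⟨h.nodup hv.1, fun p hp => h.mem_iff.1 (hv.2.1 p (h.mem_iff.2 hp)),
    fun p hp q hq => hv.2.2 p (h.mem_iff.2 hp) q (h.mem_iff.2 hq)⟩

/-- The over-strand of the new kink gets the base color `g`, and conjugating `g` by itself changes
nothing. -/
theorem Transfers.first {k : ℕ} {o s : Bool} {A : GaussWord}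
    (hc : GaussWord.IsCode ([⟨k, o, s⟩, ⟨k, !o, s⟩] ++ A)) :
    Transfers A ([⟨k, o, s⟩, ⟨k, !o, s⟩] ++ A) := by
  rintro G _ h g ⟨hf, hr⟩
  have hk := hc.label_ne (p := ⟨k, o, s⟩) (by simp) (by simp [Passage.partner])
  have e : ∀ p ∈ A, h p.label = Function.update h k g p.label := fun p hp => by
    rw [Function.update_of_ne (hk p hp)]
  have hg : step (Function.update h k g) ⟨k, !o, s⟩ (step (Function.update h k g) ⟨k, o, s⟩ g)
      = g := by
    cases o <;> simp [step]
  refine ⟨Function.update h k g, g, ⟨?_, ?_⟩, IsConj.refl g, fun H hg hH => ⟨hg, fun p hp => ?_⟩⟩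
  · rw [List.cons_append, fits_cons, List.cons_append, fits_cons, hg, List.nil_append,
      ← fits_congr e]
    refine ⟨by simp, fun _ => ?_, hf⟩
    cases o <;> simp [step]
  · rw [List.cons_append, run_cons, List.cons_append, run_cons, hg, List.nil_append,
      ← run_congr e, hr]
  · rw [e p hp]; exact hH p (by simp [hp])

/-- The over-color of a kink must equal `g`: if the under-passage comes first, then `h k` is `g`
conjugated by `h k` or its inverse. -/
theorem Transfers.first_symm (k : ℕ) (o s : Bool) (A : GaussWord) :
    Transfers ([⟨k, o, s⟩, ⟨k, !o, s⟩] ++ A) A := by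
  rintro G _ h g ⟨hf, hr⟩
  rw [fits_append] at hf
  rw [run_append] at hr
  have hkg : h k = g := by
    have h1 := hf.1
    cases o
    · simp only [fits_cons, step, Bool.not_false] at h1
      cases s
      · have h2 : h k = h k * g * (h k)⁻¹ := by simpa using h1
        rwa [eq_mul_inv_iff_mul_eq, mul_left_cancel_iff] at h2
      · have h2 : h k = (h k)⁻¹ * g * h k := by simpa using h1
        rwa [right_eq_mul, inv_mul_eq_one] at h2
    · simpa [step] using h1
  have hg : run h [⟨k, o, s⟩, ⟨k, !o, s⟩] g = g := by
    cases o <;> simp [step, hkg]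
  rw [hg] at hf hr
  refine ⟨h, g, ⟨hf.2, hr⟩, IsConj.refl g, fun H hg hH => ⟨hg, fun p hp => ?_⟩⟩
  simp only [List.cons_append, List.nil_append, List.mem_cons] at hp
  rcases hp with rfl | rfl | hp
  exacts [hkg ▸ hg, hkg ▸ hg, hH p hp]

theorem run_under_pair {h : ℕ → G} {k l : ℕ} (e : h k = h l) (s d : Bool) (g : G) :
    run h (strand d ⟨k, false, s⟩ ⟨l, false, !s⟩) g = g := by
  cases d <;> cases s <;> simp [strand, step, e, mul_assoc]

theorem fits_under_pair (h : ℕ → G) (k l : ℕ) (s d : Bool) (g : G) :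
    Fits h (strand d ⟨k, false, s⟩ ⟨l, false, !s⟩) g := by
  cases d <;> simp [strand]

theorem run_over_pair (h : ℕ → G) (k l : ℕ) (s t d : Bool) (g : G) :
    run h (strand d ⟨k, true, s⟩ ⟨l, true, t⟩) g = g := by
  cases d <;> simp [strand, step]

theorem fits_over_pair (h : ℕ → G) (k l : ℕ) (s t d : Bool) (g : G) :
    Fits h (strand d ⟨k, true, s⟩ ⟨l, true, t⟩) g ↔ h k = g ∧ h l = g := by
  cases d <;> simp [strand, step, and_comm]

theorem strand_perm (d : Bool) (x y : Passage) : (strand d x y).Perm [x, y] := by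
  cases d
  exacts [List.Perm.swap .., List.Perm.refl _]

theorem Transfers.second {k l : ℕ} {o s d : Bool} {A B : GaussWord}
    (hc : GaussWord.IsCode
      ([⟨k, o, s⟩, ⟨l, o, !s⟩] ++ A ++ strand d ⟨k, !o, s⟩ ⟨l, !o, !s⟩ ++ B)) :
    Transfers (A ++ B)
      ([⟨k, o, s⟩, ⟨l, o, !s⟩] ++ A ++ strand d ⟨k, !o, s⟩ ⟨l, !o, !s⟩ ++ B) := by
  rintro G _ h g ⟨hf, hr⟩
  have hc' : GaussWord.IsCode
      ([⟨k, o, s⟩, ⟨l, o, !s⟩, ⟨k, !o, s⟩, ⟨l, !o, !s⟩] ++ (A ++ B)) := by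
    refine hc.perm ?_
    have := strand_perm d ⟨k, !o, s⟩ ⟨l, !o, !s⟩
    rw [List.append_assoc, List.append_assoc]
    refine List.Perm.append_left [_, _] ?_
    refine (List.perm_append_comm_assoc _ _ _).trans ?_
    exact this.append_right _
  have hk := hc'.label_ne (p := ⟨k, o, s⟩) (by simp) (by simp [Passage.partner])
  have hl := hc'.label_ne (p := ⟨l, o, !s⟩) (by simp) (by simp [Passage.partner])
  rw [fits_append] at hf
  rw [run_append] at hr
  -- The color of the over-strand of the two new crossings, which is met at the base point or after
  -- `A`.
  set x := if o then g else run h A g with hx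
  set h' := Function.update (Function.update h k x) l x with hh'
  have e : ∀ p ∈ A ++ B, h p.label = h' p.label := fun p hp => by
    rw [hh', Function.update_of_ne (hl p hp), Function.update_of_ne (hk p hp)]
  have eA : ∀ p ∈ A, h p.label = h' p.label := fun p hp => e p (by simp [hp])
  have eB : ∀ p ∈ B, h p.label = h' p.label := fun p hp => e p (by simp [hp])
  have e₁ : h' l = x := by simp [hh']
  have e₂ : h' k = x := by
    by_cases hkl : k = l
    · rw [hkl, e₁]
    · simp [hh', hkl]
  refine ⟨h', g, ?_, IsConj.refl g, fun H hg hH => ⟨hg, fun p hp => ?_⟩⟩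
  · cases o
    · have h₁ : run h' [⟨k, false, s⟩, ⟨l, false, !s⟩] g = g :=
        run_under_pair (e₂.trans e₁.symm) s true g
      have h₂ := fits_under_pair h' k l s true g
      simp only [strand, if_true] at h₂
      simp only [IsColoring, run_append, fits_append, h₁, Bool.not_false, run_over_pair,
        fits_over_pair, ← fits_congr eA, ← fits_congr eB, ← run_congr eA, ← run_congr eB, e₁, e₂]
      exact ⟨⟨⟨⟨h₂, hf.1⟩, by simp [hx]⟩, hf.2⟩, hr⟩
    · have h₁ : run h' [⟨k, true, s⟩, ⟨l, true, !s⟩] g = g := run_over_pair h' k l s (!s) true g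
      have h₂ := (fits_over_pair h' k l s (!s) true g).2 ⟨by simp [e₂, hx], by simp [e₁, hx]⟩
      simp only [strand, if_true] at h₂
      simp only [IsColoring, run_append, fits_append, h₁, Bool.not_true,
        run_under_pair (e₂.trans e₁.symm),
        ← fits_congr eA, ← fits_congr eB, ← run_congr eA, ← run_congr eB]
      exact ⟨⟨⟨⟨h₂, hf.1⟩, fits_under_pair _ _ _ _ _ _⟩, hf.2⟩, hr⟩
  · rw [e p hp]
    refine hH p ?_
    simp only [List.mem_append] at hp ⊢
    tauto

theorem Transfers.second_symm (k l : ℕ) (o s d : Bool) (A B : GaussWord) :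
    Transfers ([⟨k, o, s⟩, ⟨l, o, !s⟩] ++ A ++ strand d ⟨k, !o, s⟩ ⟨l, !o, !s⟩ ++ B)
      (A ++ B) := by
  rintro G _ h g ⟨hf, hr⟩
  have hst : [⟨k, o, s⟩, ⟨l, o, !s⟩] = strand true ⟨k, o, s⟩ ⟨l, o, !s⟩ := rfl
  rw [hst] at hf hr ⊢
  have hmem : ∀ {x : G} (H : Subgroup G), h k = x → h l = x → x ∈ H →
      (∀ p ∈ A ++ B, h p.label ∈ H) → ∀ p ∈ strand true ⟨k, o, s⟩ ⟨l, o, !s⟩ ++ A ++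
        strand d ⟨k, !o, s⟩ ⟨l, !o, !s⟩ ++ B, h p.label ∈ H := by
    intro x H hk hl hx hH p hp
    simp only [List.mem_append, (strand_perm _ _ _).mem_iff, List.mem_cons, List.not_mem_nil,
      or_false] at hp hH
    rcases hp with (((rfl | rfl) | hp) | rfl | rfl) | hp
    · exact hk ▸ hx
    · exact hl ▸ hx
    · exact hH p (.inl hp)
    · exact hk ▸ hx
    · exact hl ▸ hx
    · exact hH p (.inr hp)
  cases o
  · simp only [run_append, fits_append, Bool.not_false, run_over_pair, fits_over_pair] at hf hr
    obtain ⟨⟨⟨-, hA⟩, hk, hl⟩, hB⟩ := hf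
    have hg := run_under_pair (hk.trans hl.symm) s true g
    rw [hg] at hA hk hl hB hr
    refine ⟨h, g, ⟨by simp [hA, hB], by simp [hr]⟩, IsConj.refl g, fun H hg hH => ⟨hg, ?_⟩⟩
    exact hmem H hk hl ((run_mem_iff fun p hp => hH p (by simp [hp])).2 hg) hH
  · simp only [run_append, fits_append, Bool.not_true, run_over_pair, fits_over_pair] at hf hr
    obtain ⟨⟨⟨⟨hk, hl⟩, hA⟩, -⟩, hB⟩ := hf
    rw [run_under_pair (hk.trans hl.symm)] at hB hr
    refine ⟨h, g, ⟨by simp [hA, hB], by simp [hr]⟩, IsConj.refl g, fun H hg hH => ⟨hg, ?_⟩⟩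
    exact hmem H hk hl hg hH

end Coloring

end FourMove

namespace FourMove

/-! ### The third Reidemeister move -/

section ThirdMove

variable {G : Type*} [Group G]

/-- Only the color at `c` changes: the middle strand now passes over `c` on the other side of its
underpass at `a`. The old and new colors there differ by conjugation by the common top color `h a =
h b`. The sign condition `hab` makes this compensate for the bottom strand meeting `b` and `c` in
the opposite order. -/
theorem exists_third_update {a b c : ℕ} {sa sb sc dt dm db : Bool}
    (hab : (sa ^^ sb) = (dm ^^ db)) (hac : (sa ^^ sc) = (dt ^^ db)) (ac : a ≠ c) (bc : b ≠ c)
    {h : ℕ → G} {m : G} (hh : h a = h b)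
    (hm : Fits h (strand dm ⟨a, false, sa⟩ ⟨c, true, sc⟩) m) :
    ∃ y, Fits (Function.update h c y) (strand (!dm) ⟨a, false, sa⟩ ⟨c, true, sc⟩) m ∧
      run (Function.update h c y) (strand (!dm) ⟨a, false, sa⟩ ⟨c, true, sc⟩) m =
        run h (strand dm ⟨a, false, sa⟩ ⟨c, true, sc⟩) m ∧
      (∀ x, run (Function.update h c y) (strand (!db) ⟨b, false, sb⟩ ⟨c, false, sc⟩) x =
        run h (strand db ⟨b, false, sb⟩ ⟨c, false, sc⟩) x) ∧
      ∀ H : Subgroup G, h a ∈ H → y ∈ H → h c ∈ H := by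
  refine ⟨if dm then m else step h ⟨a, false, sa⟩ m, ?_⟩
  have key : ∀ H : Subgroup G, h a ∈ H → (step h ⟨a, false, sa⟩ m ∈ H ↔ m ∈ H) :=
    fun H ha => step_mem_iff ha
  have hba : h b = h a := hh.symm
  cases dm <;> cases db <;> cases sa <;> cases sb <;> simp at hab <;>
    simp_all [strand, step, Function.update_of_ne, mul_assoc]

theorem third_labels_ne {a b c : ℕ} {sa sb sc : Bool} {W : GaussWord}
    (hc : GaussWord.IsCode ([⟨a, true, sa⟩, ⟨b, true, sb⟩, ⟨a, false, sa⟩, ⟨c, true, sc⟩,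
      ⟨b, false, sb⟩, ⟨c, false, sc⟩] ++ W)) :
    a ≠ c ∧ b ≠ c ∧ ∀ p ∈ W, p.label ≠ c := by
  refine ⟨?_, ?_, hc.label_ne (p := ⟨c, true, sc⟩) (by simp) (by simp [Passage.partner])⟩
  · rintro rfl
    have hs : sa = sc := hc.2.2 ⟨a, false, sa⟩ (by simp) ⟨a, false, sc⟩ (by simp) rfl
    have := hc.1
    simp [hs] at this
  · rintro rfl
    have hs : sb = sc := hc.2.2 ⟨b, false, sb⟩ (by simp) ⟨b, false, sc⟩ (by simp) rfl
    have := hc.1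
    simp [hs] at this

theorem mem_of_update {W W' : GaussWord} {h : ℕ → G} {c : ℕ} {y : G} {H : Subgroup G}
    (hW : ∀ p ∈ W, p ∈ W')
    (hH : ∀ p ∈ W', Function.update h c y p.label ∈ H) (hc : h c ∈ H) :
    ∀ p ∈ W, h p.label ∈ H := by
  intro p hp
  by_cases e : p.label = c
  · rwa [e]
  · simpa [e] using hH p (hW p hp)

theorem mem_strand {d : Bool} {x y p : Passage} : p ∈ strand d x y ↔ p = x ∨ p = y := by
  rw [(strand_perm d x y).mem_iff]; simp

theorem Transfers.third {a b c : ℕ} {sa sb sc dt dm db : Bool} {A B C : GaussWord}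
    (hab : (sa ^^ sb) = (dm ^^ db)) (hac : (sa ^^ sc) = (dt ^^ db))
    (hcode : GaussWord.IsCode (strand dt ⟨a, true, sa⟩ ⟨b, true, sb⟩ ++ A ++
          strand dm ⟨a, false, sa⟩ ⟨c, true, sc⟩ ++ B ++
          strand db ⟨b, false, sb⟩ ⟨c, false, sc⟩ ++ C)) :
    Transfers (strand dt ⟨a, true, sa⟩ ⟨b, true, sb⟩ ++ A ++
          strand dm ⟨a, false, sa⟩ ⟨c, true, sc⟩ ++ B ++
          strand db ⟨b, false, sb⟩ ⟨c, false, sc⟩ ++ C)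
        (strand (!dt) ⟨a, true, sa⟩ ⟨b, true, sb⟩ ++ A ++
          strand (!dm) ⟨a, false, sa⟩ ⟨c, true, sc⟩ ++ B ++
          strand (!db) ⟨b, false, sb⟩ ⟨c, false, sc⟩ ++ C) := by
  rintro G _ h g ⟨hf, hr⟩
  obtain ⟨ac, bc, hW⟩ := third_labels_ne (a := a) (b := b) (c := c) (sa := sa) (sb := sb)
    (sc := sc) (W := A ++ (B ++ C)) (hcode.perm (by
      rw [List.perm_iff_count]
      intro p
      simp only [List.count_append, (strand_perm _ _ _).count_eq, List.count_cons, List.count_nil]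
      ring))
  have fitsN : ∀ (h : ℕ → G) d x, Fits h (strand d ⟨b, false, sb⟩ ⟨c, false, sc⟩) x := by
    intro h d x; cases d <;> simp [strand]
  simp only [run_append, fits_append, run_over_pair, fits_over_pair] at hf hr
  obtain ⟨⟨⟨⟨⟨⟨ha, hb⟩, hA⟩, hM⟩, hB⟩, -⟩, hC⟩ := hf
  obtain ⟨y, h₁, h₂, h₃, h₄⟩ := exists_third_update hab hac ac bc (ha.trans hb.symm) hM
  have e : ∀ p ∈ A ++ (B ++ C), h p.label = Function.update h c y p.label := fun p hp => by
    rw [Function.update_of_ne (hW p hp)]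
  have eA : ∀ p ∈ A, h p.label = Function.update h c y p.label := fun p hp => e p (by simp [hp])
  have eB : ∀ p ∈ B, h p.label = Function.update h c y p.label := fun p hp => e p (by simp [hp])
  have eC : ∀ p ∈ C, h p.label = Function.update h c y p.label := fun p hp => e p (by simp [hp])
  refine ⟨Function.update h c y, g, ?_, IsConj.refl g, fun H hg hH => ⟨hg, ?_⟩⟩
  · simp only [IsColoring, run_append, fits_append, run_over_pair, fits_over_pair,
      ← fits_congr eA, ← fits_congr eB, ← fits_congr eC, ← run_congr eA, ← run_congr eB,
      ← run_congr eC, h₂, h₃, Function.update_of_ne ac, Function.update_of_ne bc]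
    exact ⟨⟨⟨⟨⟨⟨⟨ha, hb⟩, hA⟩, h₁⟩, hB⟩, fitsN _ _ _⟩, hC⟩, hr⟩
  · refine mem_of_update (fun p hp => ?_) hH (h₄ H ?_ ?_)
    · simpa only [List.mem_append, mem_strand] using hp
    · simpa [ac] using hH ⟨a, true, sa⟩ (by simp [mem_strand])
    · simpa using hH ⟨c, true, sc⟩ (by simp [mem_strand])

theorem Transfers.third' {a b c : ℕ} {sa sb sc dt dm db : Bool} {A B C : GaussWord}
    (hab : (sa ^^ sb) = (dm ^^ db)) (hac : (sa ^^ sc) = (dt ^^ db))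
    (hcode : GaussWord.IsCode (strand dt ⟨a, true, sa⟩ ⟨b, true, sb⟩ ++ A ++
          strand db ⟨b, false, sb⟩ ⟨c, false, sc⟩ ++ B ++
          strand dm ⟨a, false, sa⟩ ⟨c, true, sc⟩ ++ C)) :
    Transfers (strand dt ⟨a, true, sa⟩ ⟨b, true, sb⟩ ++ A ++
          strand db ⟨b, false, sb⟩ ⟨c, false, sc⟩ ++ B ++
          strand dm ⟨a, false, sa⟩ ⟨c, true, sc⟩ ++ C)
        (strand (!dt) ⟨a, true, sa⟩ ⟨b, true, sb⟩ ++ A ++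
          strand (!db) ⟨b, false, sb⟩ ⟨c, false, sc⟩ ++ B ++
          strand (!dm) ⟨a, false, sa⟩ ⟨c, true, sc⟩ ++ C) := by
  rintro G _ h g ⟨hf, hr⟩
  obtain ⟨ac, bc, hW⟩ := third_labels_ne (a := a) (b := b) (c := c) (sa := sa) (sb := sb)
    (sc := sc) (W := A ++ (B ++ C)) (hcode.perm (by
      rw [List.perm_iff_count]
      intro p
      simp only [List.count_append, (strand_perm _ _ _).count_eq, List.count_cons, List.count_nil]
      ring))
  have fitsN : ∀ (h : ℕ → G) d x, Fits h (strand d ⟨b, false, sb⟩ ⟨c, false, sc⟩) x := by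
    intro h d x; cases d <;> simp [strand]
  simp only [run_append, fits_append, run_over_pair, fits_over_pair] at hf hr
  obtain ⟨⟨⟨⟨⟨⟨ha, hb⟩, hA⟩, -⟩, hB⟩, hM⟩, hC⟩ := hf
  obtain ⟨y, h₁, h₂, h₃, h₄⟩ := exists_third_update hab hac ac bc (ha.trans hb.symm) hM
  have e : ∀ p ∈ A ++ (B ++ C), h p.label = Function.update h c y p.label := fun p hp => by
    rw [Function.update_of_ne (hW p hp)]
  have eA : ∀ p ∈ A, h p.label = Function.update h c y p.label := fun p hp => e p (by simp [hp])
  have eB : ∀ p ∈ B, h p.label = Function.update h c y p.label := fun p hp => e p (by simp [hp])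
  have eC : ∀ p ∈ C, h p.label = Function.update h c y p.label := fun p hp => e p (by simp [hp])
  refine ⟨Function.update h c y, g, ?_, IsConj.refl g, fun H hg hH => ⟨hg, ?_⟩⟩
  · simp only [IsColoring, run_append, fits_append, run_over_pair, fits_over_pair,
      ← fits_congr eA, ← fits_congr eB, ← fits_congr eC, ← run_congr eA, ← run_congr eB,
      ← run_congr eC, h₂, h₃, Function.update_of_ne ac, Function.update_of_ne bc]
    exact ⟨⟨⟨⟨⟨⟨⟨ha, hb⟩, hA⟩, fitsN _ _ _⟩, hB⟩, h₁⟩, hC⟩, hr⟩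
  · refine mem_of_update (fun p hp => ?_) hH (h₄ H ?_ ?_)
    · simpa only [List.mem_append, mem_strand] using hp
    · simpa [ac] using hH ⟨a, true, sa⟩ (by simp [mem_strand])
    · simpa using hH ⟨c, true, sc⟩ (by simp [mem_strand])

end ThirdMove

/-! ### Invariance of generation by conjugates of the base color -/

theorem Transfers.of_move {w w' : GaussWord} (hw : w.IsCode) (hw' : w'.IsCode) (m : Move w w') :
    Transfers w w' ∧ Transfers w' w := by
  cases m with
  | rotate A B => exact ⟨.rotate A B, .rotate B A⟩
  | relabel σ => exact ⟨.relabel σ w, .relabel_symm σ w⟩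
  | first k o s => exact ⟨.first hw', .first_symm k o s w⟩
  | second k l o s d A B => exact ⟨.second hw', .second_symm k l o s d A B⟩
  | third a b c sa sb sc dt dm db A B C hab hac =>
    refine ⟨.third hab hac hw, ?_⟩
    -- The inverse move is the same move with all three directions flipped, which preserves the sign
    -- conditions.
    simpa only [Bool.not_not] using Transfers.third (dt := !dt) (dm := !dm) (db := !db)
      (by simpa using hab) (by simpa using hac) hw'
  | third' a b c sa sb sc dt dm db A B C hab hac =>
    refine ⟨.third' hab hac hw, ?_⟩
    simpa only [Bool.not_not] using Transfers.third' (dt := !dt) (dm := !dm) (db := !db)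
      (by simpa using hab) (by simpa using hac) hw'

/-- Whenever the colors of a coloring of `w` generate a group, then so do `n` conjugates of its
base color. -/
def GeneratedByConjugates (w : GaussWord) (n : ℕ) : Prop :=
  ∀ (G : Type) [Group G] (h : ℕ → G) (g : G), IsColoring w h g →
    (∀ H : Subgroup G, g ∈ H → (∀ p ∈ w, h p.label ∈ H) → H = ⊤) →
      ∃ m : Fin n → G, (∀ i, IsConj g (m i)) ∧ Subgroup.closure (Set.range m) = ⊤

theorem GeneratedByConjugates.of_transfers {w w' : GaussWord} {n : ℕ} (t : Transfers w w')
    (hw' : GeneratedByConjugates w' n) : GeneratedByConjugates w n := by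
  intro G _ h g hc hgen
  obtain ⟨h', g', hc', hgg', hH⟩ := t G h g hc
  obtain ⟨m, hm, hcl⟩ := hw' G h' g' hc' fun H hg hp =>
    hgen H (hH H hg hp).1 (hH H hg hp).2
  exact ⟨m, fun i => hgg'.trans (hm i), hcl⟩

theorem generatedByConjugates_iff {D E : KnotDiagram} {K : Knot} (hD : D.Represents K)
    (hE : E.Represents K) (n : ℕ) :
    GeneratedByConjugates D.word n ↔ GeneratedByConjugates E.word n := by
  have h : Relation.EqvGen (fun D E : KnotDiagram => Move D.word E.word) D E :=
    Quotient.exact (hD.trans hE.symm)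
  induction h generalizing K with
  | rel D E m =>
    have := Transfers.of_move D.isCode E.isCode m
    exact ⟨.of_transfers this.2, .of_transfers this.1⟩
  | refl => rfl
  | symm D E _ ih => exact (ih (K := K) hE hD).symm
  | trans D F E h₁ h₂ ih₁ ih₂ =>
    exact (ih₁ (K := Quotient.mk _ D) rfl (Quotient.sound h₁.symm)).trans
      (ih₂ (K := Quotient.mk _ F) rfl (Quotient.sound h₂.symm))

end FourMove

namespace FourMove

/-! ### Colorings by edges -/

section Edges

variable {G : Type*} [Group G]

theorem run_take_succ (h : ℕ → G) (w : GaussWord) (g : G) {k : ℕ} (hk : k < w.length) :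
    run h (w.take (k + 1)) g = step h w[k] (run h (w.take k) g) := by
  rw [List.take_add_one, List.getElem?_eq_getElem hk, run_append]
  rfl

theorem Fits.label_eq {h : ℕ → G} {w : GaussWord} {g : G} (hf : Fits h w g) {k : ℕ}
    (hk : k < w.length) (ho : w[k].isOver = true) : h w[k].label = run h (w.take k) g := by
  rw [← List.take_append_drop k w, List.drop_eq_getElem_cons hk, fits_append, fits_cons] at hf
  exact hf.2.1 ho

/-- A coloring of the edges that satisfies the Wirtinger relations. -/
theorem exists_isColoring {w : GaussWord} (hw : w.IsCode) (f : ℕ → G)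
    (hclosed : f w.length = f 0)
    (hover : ∀ i (hi : i < w.length), w[i].isOver = true → f (i + 1) = f i)
    (hunder : ∀ i j (hi : i < w.length) (hj : j < w.length), w[i].isOver = false →
      w[j] = w[i].partner →
      f (i + 1) = if w[i].isPos then (f j)⁻¹ * f i * f j else f j * f i * (f j)⁻¹) :
    ∃ h : ℕ → G, IsColoring w h (f 0) ∧ ∀ k ≤ w.length, run h (w.take k) (f 0) = f k := by
  have hex : ∀ l : ℕ, ∃ x : G, ∀ j (hj : j < w.length), w[j].isOver = true → w[j].label = l →
      x = f j := by
    intro l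
    by_cases he : ∃ j, ∃ hj : j < w.length, w[j].isOver = true ∧ w[j].label = l
    · obtain ⟨j, hj, ho, rfl⟩ := he
      refine ⟨f j, fun k hk hko hkl => ?_⟩
      rcases hw.eq_or_eq (List.getElem_mem hj) (List.getElem_mem hk) hkl with e | e
      · rw [(hw.1.getElem_inj_iff).1 e]
      · rw [e] at hko
        simp [Passage.partner, ho] at hko
    · push Not at he
      -- Labels without an over-passage get the irrelevant color `1`.
      exact ⟨1, fun j hj ho hl => absurd hl (he j hj ho)⟩
  choose h hh using hex
  have hlabel : ∀ j (hj : j < w.length), w[j].isOver = true → h w[j].label = f j :=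
    fun j hj ho => hh _ j hj ho rfl
  have hstep : ∀ i (hi : i < w.length), step h w[i] (f i) = f (i + 1) := by
    intro i hi
    cases ho : w[i].isOver
    · obtain ⟨j, hj, e⟩ := List.getElem_of_mem (hw.2.1 _ (List.getElem_mem hi))
      have hl : h w[i].label = f j := by
        rw [← hlabel j hj (by simp [e, Passage.partner, ho]), e]; rfl
      rw [hunder i j hi hj ho e, step, ho, hl]
      simp
    · rw [hover i hi ho, step, if_pos ho]
  have hdrop : ∀ m k, k + m = w.length →
      Fits h (w.drop k) (f k) ∧ run h (w.drop k) (f k) = f w.length := by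
    intro m
    induction m with
    | zero => rintro k rfl; simp
    | succ m ih =>
      intro k hk
      have hk' : k < w.length := by omega
      rw [List.drop_eq_getElem_cons hk', fits_cons, run_cons, hstep k hk']
      have := ih (k + 1) (by omega)
      exact ⟨⟨hlabel k hk', this.1⟩, this.2⟩
  have := hdrop w.length 0 (by omega)
  rw [List.drop_zero, hclosed] at this
  refine ⟨h, this, fun k => ?_⟩
  induction k with
  | zero => simp
  | succ k ih =>
    intro hk
    rw [run_take_succ h w _ hk, ih (by omega), hstep k hk]

end Edges

theorem GaussWord.val_next (w : GaussWord) (i : Fin w.length) :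
    (w.next i : ℕ) = (i + 1) % w.length := by
  have : ∀ (n : ℕ) (i : Fin n), (finRotate n i : ℕ) = (i + 1) % n := by
    intro n i
    cases n with
    | zero => exact i.elim0
    | succ n => rw [finRotate_apply, Fin.val_add]; simp
  exact this _ i

/-- The colors of the overbridges generate the group. -/
theorem KnotDiagram.generatedByConjugates_bridgeCount (D : KnotDiagram) (hne : D.word ≠ []) :
    GeneratedByConjugates D.word D.bridgeCount := by
  intro G _ h g ⟨hf, hr⟩ hgen
  set w := D.word with hw
  have hpos : 0 < w.length := List.length_pos_iff.2 hne
  let f : ℕ → G := fun k => run h (w.take k) g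
  have fn : f w.length = f 0 := by simp only [f, List.take_length, hr, List.take_zero, run_nil]
  have fmod : ∀ i, i < w.length → f ((i + 1) % w.length) = f (i + 1) := by
    intro i hi
    rcases Nat.lt_or_ge (i + 1) w.length with h1 | h1
    · rw [Nat.mod_eq_of_lt h1]
    · rw [show i + 1 = w.length by omega, Nat.mod_self, fn]
  have hcard : D.bridgeCount = (Finset.univ.filter fun i : Fin w.length =>
      (w.get i).isOver = false ∧ (w.get (w.next i)).isOver = true).card := by
    rw [KnotDiagram.bridgeCount, if_neg hne]
  let e := Finset.equivFinOfCardEq hcard.symm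
  refine ⟨fun i => f (w.next (e.symm i).1), fun i => isConj_run _ _ _, ?_⟩
  set H := Subgroup.closure (Set.range fun i => f (w.next (e.symm i).1))
  have hstart : ∀ i : Fin w.length, (w.get i).isOver = false →
      (w.get (w.next i)).isOver = true → f (w.next i) ∈ H := by
    intro i h1 h2
    refine Subgroup.subset_closure ⟨e ⟨i, by simpa using And.intro h1 h2⟩, ?_⟩
    simp only [Equiv.symm_apply_apply]
  -- An underpass, from which the walk along the knot can start outside every overbridge.
  obtain ⟨u, hu, huo⟩ : ∃ u, ∃ hu : u < w.length, w[u].isOver = false := by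
    cases ho : w[0].isOver
    · exact ⟨0, hpos, ho⟩
    · obtain ⟨j, hj, e⟩ := List.getElem_of_mem (D.isCode.2.1 _ (List.getElem_mem hpos))
      exact ⟨j, hj, by rw [e]; simp [Passage.partner, ho]⟩
  have hlt : ∀ k, k % w.length < w.length := fun k => Nat.mod_lt _ hpos
  -- An over-passage either begins an overbridge or has the color of the over-passage before it.
  have hover : ∀ k, u ≤ k → (w[k % w.length]'(hlt k)).isOver = true → f (k % w.length) ∈ H := by
    intro k hk
    induction k, hk using Nat.le_induction with
    | base =>
      intro ho
      simp [Nat.mod_eq_of_lt hu, huo] at ho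
    | succ k _ ih =>
      intro ho
      have e : (k + 1) % w.length = (k % w.length + 1) % w.length := by simp
      have en : (k + 1) % w.length = w.next ⟨k % w.length, hlt k⟩ := by rw [w.val_next, e]
      cases ho' : (w[k % w.length]'(hlt k)).isOver
      · rw [en]
        refine hstart _ ho' ?_
        simpa only [List.get_eq_getElem, ← en] using ho
      · rw [e, fmod _ (hlt k)]
        simp only [f]
        rw [run_take_succ h w g (hlt k), step, if_pos ho']
        exact ih ho'
  have hlabel : ∀ p ∈ w, h p.label ∈ H := by
    have : ∀ p ∈ w, p.isOver = true → h p.label ∈ H := by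
      intro p hp ho
      obtain ⟨j, hj, rfl⟩ := List.getElem_of_mem hp
      rw [hf.label_eq hj ho]
      -- One extra turn around the knot puts the index of any passage beyond `u`.
      have hj' : (j + w.length) % w.length = j := by
        rw [Nat.add_mod_right, Nat.mod_eq_of_lt hj]
      have := hover (j + w.length) (by omega)
      simp only [hj'] at this
      exact this ho
    intro p hp
    cases ho : p.isOver
    · exact this p.partner (D.isCode.2.1 p hp) (by simp [Passage.partner, ho])
    · exact this p hp ho
  -- The base edge may lie on no overbridge, but its color is linked to that of an over-passage by
  -- conjugations with elements of `H`.
  have hg : g ∈ H := by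
    obtain ⟨j, hj, e⟩ := List.getElem_of_mem (D.isCode.2.1 _ (List.getElem_mem hu))
    have ho : w[j].isOver = true := by rw [e]; simp [Passage.partner, huo]
    have h1 := hlabel _ (List.getElem_mem hj)
    rw [hf.label_eq hj ho] at h1
    exact (run_mem_iff fun p hp => hlabel p (List.mem_of_mem_take hp)).1 h1
  exact hgen H hg hlabel

/-! ### Colorings and the Wirtinger presentation -/

namespace KnotDiagram

variable (D : KnotDiagram)

/-- The unbroken strand that contains a given edge. -/
def arc (e : Fin (D.word.length + 1)) : D.Arc := Quot.mk D.Joined e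

theorem arc_surjective : Function.Surjective D.arc := Quot.mk_surjective

theorem arc_last : D.arc (Fin.last _) = D.arc 0 := Quot.sound Joined.basePoint

theorem arc_succ (i : Fin D.word.length) (h : (D.word.get i).isOver = true) :
    D.arc i.succ = D.arc i.castSucc := (Quot.sound (Joined.overpass i h)).symm

theorem lift_gen {G : Type*} [Group G] (f : D.Arc → G) (e : Fin (D.word.length + 1)) :
    FreeGroup.lift f (D.gen e) = f (D.arc e) := FreeGroup.lift_apply_of

theorem exists_hom_of_isColoring {G : Type*} [Group G] {h : ℕ → G} {g : G}
    (hc : IsColoring D.word h g) :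
    ∃ φ : D.WirtingerGroup →* G, ∀ e : Fin (D.word.length + 1),
      φ (PresentedGroup.of (D.arc e)) = run h (D.word.take e) g := by
  obtain ⟨hf, hr⟩ := hc
  let f : D.Arc → G := Quot.lift (fun e => run h (D.word.take e) g) (by
    rintro _ _ (_ | ⟨i, hi⟩)
    · simp [hr]
    · rw [List.get_eq_getElem] at hi
      rw [Fin.val_succ, run_take_succ h _ g i.2, step, if_pos hi]; rfl)
  have hlift : ∀ e, FreeGroup.lift f (D.gen e) = run h (D.word.take e) g := D.lift_gen f
  refine ⟨PresentedGroup.toGroup (f := f) ?_, fun e => PresentedGroup.toGroup.of _⟩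
  rintro r ⟨i, j, hi, hj, rfl⟩
  simp only [List.get_eq_getElem] at hi hj ⊢
  have h1 : run h (D.word.take j) g = h D.word[(i : ℕ)].label := by
    rw [← hf.label_eq j.2 (by simp [hj, Passage.partner, hi]), hj]
    rfl
  have h2 := run_take_succ h D.word g i.2
  cases hs : D.word[(i : ℕ)].isPos <;> simp only [step, hi, hs] at h2 <;>
    simp [hlift, h1, h2, mul_assoc]

/-- The coloring of a diagram by generators that satisfy the Wirtinger relations. -/
theorem exists_isColoring_of_gen {G : Type*} [Group G] (f : D.Arc → G)
    (hf : ∀ r ∈ D.wirtingerRels, FreeGroup.lift f r = 1) :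
    ∃ h : ℕ → G, IsColoring D.word h (f (D.arc 0)) ∧
      ∀ e : Fin (D.word.length + 1), run h (D.word.take e) (f (D.arc 0)) = f (D.arc e) := by
  -- The reduction modulo `length + 1` does nothing on the actual edges `0, …, length`.
  let F : ℕ → G := fun k => f (D.arc (Fin.ofNat (D.word.length + 1) k))
  have hF : ∀ e : Fin (D.word.length + 1), F e = f (D.arc e) := fun e => by
    simp [F]
  have hgen : ∀ e, FreeGroup.lift f (D.gen e) = F e := fun e => by
    rw [hF, lift_gen]
  have hF0 : F 0 = f (D.arc 0) := hF 0
  obtain ⟨h, hc, hrun⟩ := exists_isColoring D.isCode F (by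
      have := hF (Fin.last _)
      rw [Fin.val_last] at this
      rw [hF0, this, arc_last]) (fun i hi ho => by
      have h1 := hF (Fin.succ ⟨i, hi⟩)
      have h2 := hF (Fin.castSucc ⟨i, hi⟩)
      rw [Fin.val_succ] at h1
      rw [Fin.val_castSucc] at h2
      rw [h1, h2, arc_succ D ⟨i, hi⟩ ho]) (fun i j hi hj ho hp => by
      have := hf _ ⟨⟨i, hi⟩, ⟨j, hj⟩, ho, hp, rfl⟩
      simp only [List.get_eq_getElem] at this
      cases hs : D.word[i].isPos
      · simp only [hs, if_false, map_mul, map_inv, hgen, Fin.val_succ, Fin.val_castSucc,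
          Bool.false_eq_true, mul_inv_eq_one] at this
        simp [← this]
      · simp only [hs, if_true, map_mul, map_inv, hgen, Fin.val_succ, Fin.val_castSucc,
          mul_inv_eq_one] at this
        simp [← this, mul_assoc])
  rw [hF0] at hc hrun
  exact ⟨h, hc, fun e => by rw [hrun e (by omega), hF]⟩

/-- A coloring is a homomorphism from the knot group, surjective if the colors generate, so the
images of the meridians generate. Those conjugate to inverses of generators are replaced by their
inverses, which generate the same subgroup and are conjugate to the base color. -/
theorem generatedByConjugates_of_isMeridian {n : ℕ} (m : Fin n → D.WirtingerGroup)
    (hm : ∀ i, D.IsMeridian (m i)) (hgen : Subgroup.closure (Set.range m) = ⊤) :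
    GeneratedByConjugates D.word n := by
  intro G _ h g hc htop
  obtain ⟨φ, hφ⟩ := D.exists_hom_of_isColoring hc
  have hsurj : Function.Surjective φ := by
    rw [← MonoidHom.range_eq_top]
    refine htop _ ⟨_, (hφ 0).trans (by simp)⟩ ?_
    have : ∀ p ∈ D.word, p.isOver = true → h p.label ∈ φ.range := by
      intro p hp ho
      obtain ⟨j, hj, rfl⟩ := List.getElem_of_mem hp
      exact ⟨_, (hφ (Fin.castSucc ⟨j, hj⟩)).trans (hc.1.label_eq hj ho).symm⟩
    intro p hp
    cases ho : p.isOver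
    · exact this p.partner (D.isCode.2.1 p hp) (by simp [Passage.partner, ho])
    · exact this p hp ho
  have hconj : ∀ i, IsConj g (φ (m i)) ∨ IsConj g (φ (m i))⁻¹ := by
    intro i
    obtain ⟨x, hx⟩ := hm i
    obtain ⟨e, rfl⟩ := D.arc_surjective x
    have hg : IsConj g (φ (PresentedGroup.of (D.arc e))) := by
      rw [hφ]; exact isConj_run _ _ _
    rcases hx with hx | hx
    · exact .inl (hg.trans (φ.map_isConj hx))
    · obtain ⟨u, hu⟩ := isConj_iff.1 hx
      refine .inr (hg.trans (isConj_iff.2 ⟨φ u, ?_⟩))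
      rw [← hu]
      simp [mul_assoc]
  have hex : ∀ i, ∃ y, IsConj g y ∧ (y = φ (m i) ∨ y = (φ (m i))⁻¹) := fun i => by
    rcases hconj i with hi | hi
    exacts [⟨_, hi, .inl rfl⟩, ⟨_, hi, .inr rfl⟩]
  choose y hy hym using hex
  refine ⟨y, hy, ?_⟩
  rw [eq_top_iff, ← Subgroup.map_top_of_surjective φ hsurj, ← hgen, MonoidHom.map_closure,
    Subgroup.closure_le]
  rintro _ ⟨_, ⟨i, rfl⟩, rfl⟩
  have hmem : y i ∈ Subgroup.closure (Set.range y) := Subgroup.subset_closure ⟨i, rfl⟩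
  rcases hym i with e | e
  · exact e ▸ hmem
  · rw [SetLike.mem_coe, ← inv_mem_iff, ← e]; exact hmem

/-! ### The groups `R₄` and `S₄` -/

theorem lift_fourMoveRels {A : Type*} [CommGroup A] (a : A) {r : FreeGroup D.Arc}
    (hr : r ∈ D.wirtingerRels ∪ D.fourMoveRels) :
    FreeGroup.lift (fun _ : D.Arc => a) r = 1 := by
  rcases hr with ⟨i, j, -, -, rfl⟩ | ⟨c, -, d, -, rfl⟩
  · split_ifs <;> simp [lift_gen]
  · rw [map_mul, map_inv, map_pow, map_pow, map_mul, map_mul, mul_comm (FreeGroup.lift _ d),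
      mul_inv_cancel]

/-- The homomorphism from `R₄` that sends all generators to `a`. -/
def toCommGroup {A : Type*} [CommGroup A] (a : A) : D.R₄ →* A :=
  PresentedGroup.toGroup (f := fun _ => a) fun _ => D.lift_fourMoveRels a

theorem toCommGroup_of {A : Type*} [CommGroup A] (a : A) (x : D.Arc) :
    D.toCommGroup a (PresentedGroup.of x) = a := PresentedGroup.toGroup.of _

theorem fourMove_mk {x y : D.R₄} {z : D.Arc}
    (hx : IsConj (PresentedGroup.of z) x ∨ IsConj (PresentedGroup.of z)⁻¹ x)
    (hy : IsConj (PresentedGroup.of z) y ∨ IsConj (PresentedGroup.of z)⁻¹ y) :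
    (x * y) ^ 2 = (y * x) ^ 2 := by
  have lift : ∀ {x : D.R₄}, IsConj (PresentedGroup.of z) x ∨ IsConj (PresentedGroup.of z)⁻¹ x →
      ∃ c ∈ D.conjugates, PresentedGroup.mk (D.wirtingerRels ∪ D.fourMoveRels) c = x := by
    rintro x (hx | hx) <;> obtain ⟨u, rfl⟩ := isConj_iff.1 hx <;>
      obtain ⟨u, rfl⟩ := PresentedGroup.mk_surjective _ u
    · exact ⟨_, ⟨u, z, .inl rfl⟩, by simp [PresentedGroup.of]⟩
    · exact ⟨_, ⟨u, z, .inr rfl⟩, by simp [PresentedGroup.of]⟩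
  obtain ⟨c, hc, rfl⟩ := lift hx
  obtain ⟨d, hd, rfl⟩ := lift hy
  have : PresentedGroup.mk (D.wirtingerRels ∪ D.fourMoveRels) ((c * d) ^ 2 * ((d * c) ^ 2)⁻¹) = 1 :=
    PresentedGroup.one_of_mem (.inr ⟨c, hc, d, hd, rfl⟩)
  rw [map_mul, map_inv, mul_inv_eq_one] at this
  simpa only [map_mul, map_pow] using this

theorem exists_zpowers_of_generatedByConjugates (hD : GeneratedByConjugates D.word 3) :
    ∃ a : D.R₄, IsConj (PresentedGroup.of (D.arc 0)) a ∧ ∀ g, g ∈ Subgroup.zpowers a := by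
  obtain ⟨h, hc, hrun⟩ := D.exists_isColoring_of_gen
    (fun x => (PresentedGroup.of x : D.R₄)) fun r hr => by
      have : FreeGroup.lift (fun x => (PresentedGroup.of x : D.R₄)) =
          PresentedGroup.mk (D.wirtingerRels ∪ D.fourMoveRels) := by
        ext x; simp [PresentedGroup.of]
      rw [this]
      exact PresentedGroup.one_of_mem (.inl hr)
  obtain ⟨m, hm, hcl⟩ := hD _ h _ hc fun H h0 hH => by
    rw [eq_top_iff, ← PresentedGroup.closure_range_of, Subgroup.closure_le]
    rintro _ ⟨x, rfl⟩
    obtain ⟨e, rfl⟩ := D.arc_surjective x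
    rw [SetLike.mem_coe, ← hrun]
    exact (run_mem_iff fun p hp => hH p (List.mem_of_mem_take hp)).2 h0
  refine ⟨m 0, hm 0, mem_zpowers_of_fourMove ((hm 0).symm.trans (hm 1))
    ((hm 0).symm.trans (hm 2)) ?_ ?_⟩
  · rw [← hcl]
    congr 1
    ext x
    simp [Fin.exists_fin_succ, eq_comm]
  · have hinv : IsConj (PresentedGroup.of (D.arc 0))⁻¹ (m 0)⁻¹ := by
      obtain ⟨u, hu⟩ := isConj_iff.1 (hm 0)
      exact isConj_iff.2 ⟨u, by rw [← hu]; simp [mul_assoc]⟩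
    exact fun x y hx hy => D.fourMove_mk (z := D.arc 0) (hx.imp (hm 0).trans hinv.trans)
      (hy.imp (hm 0).trans hinv.trans)

theorem nonempty_mulEquiv (hD : GeneratedByConjugates D.word 3) :
    Nonempty (D.S₄ ≃* Multiplicative (ZMod 2)) ∧ Nonempty (D.R₄ ≃* Multiplicative ℤ) := by
  obtain ⟨a, ha, hgen⟩ := D.exists_zpowers_of_generatedByConjugates hD
  -- In a commutative group the conjugate `a` of a generator has the same image as that generator.
  have hval : ∀ {A : Type} [CommGroup A] (t : A), D.toCommGroup t a = t := by
    intro A _ t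
    rw [← isConj_iff_eq.1 ((D.toCommGroup t).map_isConj ha), toCommGroup_of]
  constructor
  · have hsq : a ^ 2 ∈ D.squares := by
      obtain ⟨u, rfl⟩ := isConj_iff.1 ha
      have hmem : (PresentedGroup.of (D.arc 0) : D.R₄) ^ 2 ∈ D.squares :=
        Subgroup.subset_normalClosure ⟨_, rfl⟩
      rw [conj_pow]
      exact Subgroup.normalClosure_normal.conj_mem _ hmem u
    let t : Multiplicative (ZMod 2) := Multiplicative.ofAdd 1
    have hle : D.squares ≤ (D.toCommGroup t).ker := by
      refine Subgroup.normalClosure_le_normal ?_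
      rintro _ ⟨x, rfl⟩
      rw [SetLike.mem_coe, MonoidHom.mem_ker, map_pow, toCommGroup_of]
      decide
    refine ⟨MulEquiv.ofBijective (QuotientGroup.lift D.squares (D.toCommGroup t) hle)
      (And.intro ?_ ?_)⟩
    · rw [injective_iff_map_eq_one]
      intro q hq
      obtain ⟨g, rfl⟩ := QuotientGroup.mk_surjective q
      obtain ⟨k, rfl⟩ := Subgroup.mem_zpowers_iff.1 (hgen g)
      rw [QuotientGroup.lift_mk, map_zpow, hval] at hq
      have hk : ((k : ℤ) : ZMod 2) = 0 := by
        have := congrArg Multiplicative.toAdd hq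
        simpa [t] using this
      obtain ⟨l, rfl⟩ := (ZMod.intCast_zmod_eq_zero_iff_dvd k 2).1 hk
      rw [QuotientGroup.eq_one_iff, zpow_mul]
      exact zpow_mem (by exact_mod_cast hsq) l
    · intro x
      have hx : x = 1 ∨ x = t := by revert x; decide
      rcases hx with rfl | rfl
      exacts [⟨1, map_one _⟩, ⟨(a : D.S₄), hval _⟩]
  · let t : Multiplicative ℤ := Multiplicative.ofAdd 1
    refine ⟨MulEquiv.ofBijective (D.toCommGroup t)
      (And.intro ?_ fun x => ⟨a ^ x.toAdd, ?_⟩)⟩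
    · rw [injective_iff_map_eq_one]
      intro g hg
      obtain ⟨k, rfl⟩ := Subgroup.mem_zpowers_iff.1 (hgen g)
      rw [map_zpow, hval] at hg
      have hk : k = 0 := by
        have := congrArg Multiplicative.toAdd hg
        simpa [t] using this
      rw [hk, zpow_zero]
    · rw [map_zpow, hval]
      exact Multiplicative.toAdd.injective (by simp [t])

end KnotDiagram

end FourMove

/-! ### The main theorem -/

theorem mainTheorem3 (K : FourMove.Knot) :
    (K.bridgeNumber = 3 → ∀ D : FourMove.KnotDiagram, D.Represents K →
      Nonempty (D.S₄ ≃* Multiplicative (ZMod 2)) ∧ Nonempty (D.R₄ ≃* Multiplicative ℤ)) ∧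
    (K.GroupGeneratedByMeridians 3 → ∀ D : FourMove.KnotDiagram, D.Represents K →
      Nonempty (D.S₄ ≃* Multiplicative (ZMod 2)) ∧ Nonempty (D.R₄ ≃* Multiplicative ℤ)) := by
  constructor
  · intro hK D hD
    have hne : {n | ∃ D : FourMove.KnotDiagram, D.Represents K ∧ D.bridgeCount = n}.Nonempty :=
      ⟨_, D, hD, rfl⟩
    obtain ⟨E, hE, hEn⟩ := Nat.sInf_mem hne
    have hE3 : E.bridgeCount = 3 := hEn.trans hK
    -- The crossingless circle counts as one bridge, not three.
    have hw : E.word ≠ [] := fun hw => by simp [FourMove.KnotDiagram.bridgeCount, hw] at hE3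
    exact D.nonempty_mulEquiv ((FourMove.generatedByConjugates_iff hD hE 3).2
      (hE3 ▸ E.generatedByConjugates_bridgeCount hw))
  · rintro ⟨E, hE, m, hm, hgen⟩ D hD
    exact D.nonempty_mulEquiv ((FourMove.generatedByConjugates_iff hD hE 3).2
      (E.generatedByConjugates_of_isMeridian m hm hgen))
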